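/- Let $k$ be a field, $n\ge 3$ an integer, $\mathcal T$ a $k$-linear triangulated category with suspension $\Sigma$, $\mathcal T^{fd}\subseteq\mathcal T$ a triangulated subcategory and $M$ an object of $\mathcal T$. Let $\mathcal M=\operatorname{add}(M)$ be the full subcategory of direct summands of finite direct sums of copies of $M$, and suppose that $(\mathcal T,\mathcal T^{fd},\mathcal M)$ is an $n$-Calabi-Yau triple, that is: (CY1) $\mathcal T$ is Hom-finite over $k$ and Krull-Schmidt; (CY2) there is an isomorphism $D\operatorname{Hom}_{\mathcal T}(X,Y)\cong\operatorname{Hom}_{\mathcal T}(Y,\Sigma^n X)$, functorial in $X\in\mathcal T^{fd}$ and $Y\in\mathcal T$, where $D=\operatorname{Hom}_k(-,k)$; (CY3) $\mathcal M$ is silting, i.e. $\operatorname{Hom}_{\mathcal T}(\mathcal M,\Sigma^i\mathcal M)=0$ for all $i>0$ and $\mathcal T$ is the smallest triangulated subcategory of $\mathcal T$ that contains $\mathcal M$ and is closed under direct summands; moreover the pair $(\mathcal T^{\le 0},\mathcal T^{\ge 0})$ with $\mathcal T^{\le 0}=\{X:\operatorname{Hom}_{\mathcal T}(\Sigma^{i}\mathcal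 M,X)=0\ \text{for all } i<0\}$ and $\mathcal T^{\ge 0}=\{X:\operatorname{Hom}_{\mathcal T}(\Sigma^{i}\mathcal M,X)=0\ \text{for all } i>0\}$ is a $t$-structure on $\mathcal T$, and $\mathcal T^{\ge 0}\subseteq\mathcal T^{fd}$. Then in the Verdier quotient $\mathcal T/\mathcal T^{fd}$ we have $$\operatorname{Hom}_{\mathcal T/\mathcal T^{fd}}(M,\Sigma^j M)=0\qquad\text{for } j=1,\dots,n-2,$$ that is, $M$ is $(n-1)$-rigid in $\mathcal T/\mathcal T^{fd}$. -/

import Mathlib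

open CategoryTheory CategoryTheory.Limits CategoryTheory.Pretriangulated
open CategoryTheory.Triangulated

namespace CalabiYauTriple

universe w v u

/-- An additive category is Krull-Schmidt if every object is a finite direct sum of objects
with local endomorphism rings. -/
def IsKrullSchmidt (C : Type u) [Category.{v} C] [Preadditive C] [HasFiniteBiproducts C] : Prop :=
  ∀ X : C, ∃ (m : ℕ) (Y : Fin m → C),
    (∀ i, IsLocalRing (End (Y i))) ∧ Nonempty (X ≅ ⨁ Y)

/-- A `k`-linear category is Hom-finite if all its Hom-spaces are finite dimensional. -/
def IsHomFinite (k : Type w) [Field k] (C : Type u) [Category.{v} C] [Preadditive C]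
    [Linear k C] : Prop :=
  ∀ X Y : C, Module.Finite k (X ⟶ Y)

/-- `add M`: the direct summands of finite direct sums of copies of `M`. -/
def addClosure {C : Type u} [Category.{v} C] [Preadditive C] [HasFiniteBiproducts C] (M : C) :
    ObjectProperty C :=
  fun X => ∃ m : ℕ, Nonempty (Retract X (⨁ fun _ : Fin m => M))

/-- The objects isomorphic to `Σ ^ i N` with `N` in `P` and `i ∈ S`. -/
def shifts {C : Type u} [Category.{v} C] [HasShift C ℤ] (P : ObjectProperty C) (S : Set ℤ) :
    ObjectProperty C :=
  fun X => ∃ i ∈ S, ∃ N : C, P N ∧ Nonempty (X ≅ N⟦i⟧)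

section

variable {C : Type u} [Category.{v} C] [Preadditive C] [HasZeroObject C] [HasShift C ℤ]
  [∀ i : ℤ, (shiftFunctor C i).Additive] [Pretriangulated C]

/-- `P` is silting: `Hom(P, Σ ^ i P) = 0` for `i > 0`, and the whole category is the
smallest triangulated subcategory closed under direct summands that contains `P`. -/
structure IsSilting (P : ObjectProperty C) : Prop where
  presilting : ∀ (X Y : C), P X → P Y → ∀ i : ℤ, 0 < i → ∀ f : X ⟶ Y⟦i⟧, f = 0
  thick : P.IsClassicalTriangulatedGenerator

/-- A bifunctorial isomorphism `D Hom(X, Y) ≅ Hom(Y, Σ ^ n X)` for `X` in `Fd` and `Y` arbitrary,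
where `D` is the `k`-dual. -/
structure RelativeCalabiYau (k : Type w) [Field k] [Linear k C] (Fd : ObjectProperty C)
    (n : ℕ) where
  iso (X : C) (hX : Fd X) (Y : C) : Module.Dual k (X ⟶ Y) ≃ₗ[k] (Y ⟶ X⟦(n : ℤ)⟧)
  naturality_left (X X' : C) (hX : Fd X) (hX' : Fd X') (Y : C) (f : X ⟶ X')
    (φ : Module.Dual k (X ⟶ Y)) :
    iso X' hX' Y (φ ∘ₗ Linear.leftComp k Y f) = iso X hX Y φ ≫ f⟦(n : ℤ)⟧'
  naturality_right (X : C) (hX : Fd X) (Y Y' : C) (g : Y ⟶ Y')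
    (φ : Module.Dual k (X ⟶ Y')) :
    iso X hX Y (φ ∘ₗ Linear.rightComp k X g) = g ≫ iso X hX Y' φ

/-- `(C, Fd, P)` is an `n`-Calabi-Yau triple over `k`. -/
structure IsCalabiYauTriple (k : Type w) [Field k] [Linear k C] (n : ℕ)
    (Fd : ObjectProperty C) [Fd.IsTriangulated] (P : ObjectProperty C) : Prop where
  three_le : 3 ≤ n
  additive : P.IsClosedUnderFiniteProducts
  homFinite : IsHomFinite k C
  krullSchmidt : IsKrullSchmidt C
  relativeCalabiYau : Nonempty (RelativeCalabiYau k Fd n)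
  silting : IsSilting P
  /-- the right adjacent t-structure, whose coaisle lies in `Fd` -/
  adjacent : ∃ t : TStructure C,
    t.le 0 = (shifts P (Set.Iio 0)).rightOrthogonal ∧
    t.ge 0 = (shifts P (Set.Ioi 0)).rightOrthogonal ∧
    t.ge 0 ≤ Fd

end

end CalabiYauTriple

/-! A map `M ⟶ Σ^j M` in the quotient is a fraction over some `s : W ⟶ M` with cone `F` in `Tfd`. As
`M` lies in the aisle, `M ⟶ F` factors through the truncation `G` of `F`, still in `Tfd` because the
coaisle is (`exists_factorization_aisle`). The cocone `W'` of `M ⟶ G` refines the fraction, and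
`Hom(W', Σ^j M) = 0`: `Hom(M, Σ^j M)` vanishes by silting, and `Hom(G, Σ^(j+1) M)` by duality with
`Hom(Σ^(j+1) M, Σ^n G)`. -/

namespace CalabiYauTriple

section Shift

variable {C : Type*} [Category C] [Preadditive C] [HasShift C ℤ]
  [∀ i : ℤ, (shiftFunctor C i).Additive]

/-- If `Hom(Σ ^ a X, Y) = 0`, then `Hom(Σ ^ c X, Σ ^ b Y) = 0` for `c = a + b`. -/
lemma shift_hom_shift_eq_zero {X Y : C} {a : ℤ} (hXY : ∀ g : X⟦a⟧ ⟶ Y, g = 0)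
    (b c : ℤ) (h : a + b = c) (f : X⟦c⟧ ⟶ Y⟦b⟧) : f = 0 := by
  obtain ⟨g, hg⟩ := (shiftFunctor C b).map_surjective
    ((shiftFunctorAdd' C a b c h).inv.app X ≫ f)
  rw [hXY g, Functor.map_zero] at hg
  exact (cancel_epi ((shiftFunctorAdd' C a b c h).inv.app X)).1 (by rw [← hg, comp_zero])

/-- If `Hom(X, Σ ^ b Y) = 0`, then `Hom(Σ ^ (-b) X, Y) = 0`. -/
lemma shift_hom_eq_zero {X Y : C} {b : ℤ} (hXY : ∀ g : X ⟶ Y⟦b⟧, g = 0)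
    (a : ℤ) (h : a + b = 0) (f : X⟦a⟧ ⟶ Y) : f = 0 := by
  apply (shiftFunctor C b).map_injective
  rw [Functor.map_zero, ← cancel_epi ((shiftFunctorCompIsoId C a b h).inv.app X), comp_zero]
  exact hXY _

end Shift

lemma addClosure_self {C : Type*} [Category C] [Preadditive C] [HasFiniteBiproducts C] (M : C) :
    addClosure M M :=
  ⟨1, ⟨{ i := biproduct.ι (fun _ : Fin 1 => M) 0
         r := biproduct.π (fun _ : Fin 1 => M) 0
         retract := biproduct.ι_π_self _ _ }⟩⟩

/-- In the relative Calabi-Yau setting, `Hom(Y, Σ ^ n X) = 0` forces `Hom(X, Y) = 0`. -/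
lemma RelativeCalabiYau.hom_eq_zero {k C : Type*} [Field k] [Category C] [Preadditive C]
    [HasShift C ℤ] [Linear k C] {Fd : ObjectProperty C} {n : ℕ} (S : RelativeCalabiYau k Fd n) {X Y : C} (hX : Fd X)
    (hXY : ∀ g : Y ⟶ X⟦(n : ℤ)⟧, g = 0) (f : X ⟶ Y) : f = 0 := by
  rw [← Module.forall_dual_apply_eq_zero_iff k]
  intro φ
  have hφ : φ = 0 := (S.iso X hX Y).injective (by rw [hXY (S.iso X hX Y φ), map_zero])
  rw [hφ, LinearMap.zero_apply]

section Pretriangulated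

variable {C : Type*} [Category C] [Preadditive C] [HasZeroObject C] [HasShift C ℤ]
  [∀ i : ℤ, (shiftFunctor C i).Additive] [Pretriangulated C]

/-- A silting subcategory lies in the aisle of its right adjacent t-structure. -/
lemma IsSilting.le_rightOrthogonal {P : ObjectProperty C} (hP : IsSilting P) :
    P ≤ (shifts P (Set.Iio 0)).rightOrthogonal := by
  rintro Y hY X f ⟨i, hi, N, hN, ⟨e⟩⟩
  rw [← cancel_epi e.inv, comp_zero]
  exact shift_hom_eq_zero (hP.presilting N Y hN hY (-i) (by simpa using hi)) i (by simp) _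

/-- A morphism to an object of `Fd` from an object of the aisle factors through an object of `Fd`
that lies in the aisle, provided that `Fd` contains the coaisle. -/
lemma exists_factorization_aisle (Fd : ObjectProperty C) [Fd.IsTriangulated] (t : TStructure C)
    (ht : t.ge 0 ≤ Fd) {X F : C} (hX : t.le 0 X) (hF : Fd F) (c : X ⟶ F) :
    ∃ (G : C) (_ : Fd G) (_ : t.le 0 G) (a : X ⟶ G) (b : G ⟶ F), a ≫ b = c := by
  obtain ⟨A, B, hA, hB, u, v, w, hT⟩ := t.exists_triangle_zero_one F
  -- `Fd` need not be closed under isomorphism, so the truncation `A` is replaced by an isomorphic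
  -- `G` in `Fd`.
  obtain ⟨G, hG, ⟨e⟩⟩ := Fd.ext_of_isTriangulatedClosed₁' _ hT hF (ht _ (t.ge_one_le _ hB))
  obtain ⟨a, ha⟩ : ∃ a : X ⟶ A, c = a ≫ u :=
    Triangle.coyoneda_exact₂ _ hT c (t.zero' (c ≫ v) hX hB)
  let e' : A ≅ G := e
  refine ⟨G, hG, (t.le 0).prop_of_iso e' hA, a ≫ e'.hom, e'.inv ≫ u, ?_⟩
  simp [ha]

/-- If `Hom(X, Y) = 0` and `Hom(Z, Σ Y) = 0` for a distinguished triangle `W ⟶ X ⟶ Z ⟶ Σ W`,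
then `Hom(W, Y) = 0`. -/
lemma hom_eq_zero_of_distinguished {W X Z Y : C} {s : W ⟶ X} {a : X ⟶ Z} {d : Z ⟶ W⟦(1 : ℤ)⟧}
    (hT : Triangle.mk s a d ∈ distTriang C) (hX : ∀ g : X ⟶ Y, g = 0)
    (hZ : ∀ g : Z ⟶ Y⟦(1 : ℤ)⟧, g = 0) (f : W ⟶ Y) : f = 0 := by
  apply (shiftFunctor C (1 : ℤ)).map_injective
  -- The obstruction to extending `Σ f` along `-Σ s` is `d ≫ Σ f`, a map `Z ⟶ Σ Y`.
  obtain ⟨g, hg⟩ : ∃ g : X⟦(1 : ℤ)⟧ ⟶ Y⟦(1 : ℤ)⟧, f⟦(1 : ℤ)⟧' = (-s⟦(1 : ℤ)⟧') ≫ g :=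
    Triangle.yoneda_exact₃ _ (rot_of_distTriang _ hT) (f⟦(1 : ℤ)⟧') (hZ _)
  obtain ⟨g, rfl⟩ := (shiftFunctor C (1 : ℤ)).map_surjective g
  rw [hg, hX g, Functor.map_zero, Functor.map_zero, comp_zero]

/-- If every morphism `W ⟶ X` in `P.trW` is dominated by a morphism of `P.trW` whose source has
no nonzero map to `Y`, then `Hom(X, Y) = 0` in the Verdier quotient by `P`. -/
lemma verdier_hom_eq_zero [IsTriangulated C] (P : ObjectProperty C) [P.IsTriangulated] {X Y : C}
    (h : ∀ ⦃W : C⦄ (s : W ⟶ X), P.trW s → ∃ (W' : C) (u : W' ⟶ W), P.trW (u ≫ s) ∧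
      ∀ g : W' ⟶ Y, g = 0)
    (f : P.trW.Q.obj X ⟶ P.trW.Q.obj Y) : f = 0 := by
  obtain ⟨φ, rfl⟩ := Localization.exists_rightFraction P.trW.Q P.trW f
  obtain ⟨W', u, hu, hW'⟩ := h φ.s φ.hs
  have := Localization.inverts P.trW.Q P.trW _ hu
  rw [← cancel_epi (P.trW.Q.map (u ≫ φ.s)), comp_zero, Functor.map_comp, Category.assoc,
    MorphismProperty.RightFraction.map_s_comp_map, ← Functor.map_comp, hW' (u ≫ φ.f), Functor.map_zero]

end Pretriangulated

end CalabiYauTriple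

open CalabiYauTriple in
theorem mainTheorem6 {k : Type*} [Field k] {T : Type*} [Category T] [Preadditive T]
    [Linear k T] [HasZeroObject T] [HasShift T ℤ]
    [∀ i : ℤ, (shiftFunctor T i).Additive] [∀ i : ℤ, (shiftFunctor T i).Linear k]
    [Pretriangulated T] [IsTriangulated T]
    (n : ℕ) (Tfd : ObjectProperty T) [Tfd.IsTriangulated] (M : T)
    (h : CalabiYauTriple.IsCalabiYauTriple k n Tfd (CalabiYauTriple.addClosure M))
    (j : ℕ) (hj : 1 ≤ j) (hjn : j ≤ n - 2)
    (f : Tfd.trW.Q.obj M ⟶ (Tfd.trW.Q.obj M)⟦(j : ℤ)⟧) : f = 0 := by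
  obtain ⟨S⟩ := h.relativeCalabiYau
  obtain ⟨t, hle, -, hge⟩ := h.adjacent
  have hn := h.three_le
  have hM := addClosure_self M
  have hM0 : t.le 0 M := hle ▸ h.silting.le_rightOrthogonal M hM
  rw [← cancel_mono ((Tfd.trW.Q.commShiftIso (j : ℤ)).inv.app M), zero_comp]
  refine verdier_hom_eq_zero Tfd (X := M) (Y := M⟦(j : ℤ)⟧) ?_ _
  rintro W s ⟨F, c, d, hT, hF⟩
  obtain ⟨G, hG, hG0, a, b, rfl⟩ := exists_factorization_aisle Tfd t hge hM0 hF c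
  obtain ⟨W', s', d', hT'⟩ := distinguished_cocone_triangle₁ a
  have hs' : s' ≫ a = 0 := comp_distTriang_mor_zero₁₂ _ hT'
  -- `s'` kills `a`, hence also `c = a ≫ b`, so it lifts through `s`.
  obtain ⟨u, hu⟩ : ∃ u : W' ⟶ W, s' = u ≫ s := Triangle.coyoneda_exact₂ _ hT s'
    (show s' ≫ a ≫ b = 0 by rw [reassoc_of% hs', zero_comp])
  refine ⟨W', u, ?_, ?_⟩
  · rw [← hu]
    exact ⟨G, a, d', hT', hG⟩
  refine hom_eq_zero_of_distinguished hT' (h.silting.presilting M M hM hM j (by lia))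
    (S.hom_eq_zero hG fun g => ?_)
  rw [hle] at hG0
  rw [← cancel_epi ((shiftFunctorAdd' T (j : ℤ) 1 (j + 1) rfl).hom.app M), comp_zero]
  -- Desuspending by `n` leaves `Hom(Σ^(j+1-n) M, G)`; the exponent is negative exactly when `j ≤ n
  -- - 2`, so the aisle condition on `G` applies.
  exact shift_hom_shift_eq_zero (a := (j : ℤ) + 1 - n)
    (fun g => hG0 g ⟨_, by simp only [Set.mem_Iio]; lia, M, hM, ⟨Iso.refl _⟩⟩) _ _ (by lia) _
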